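/- **Definitions.** Let $P$ be a distributive lattice. An element $v\in P$ is *join-irreducible* if there are no $x,y<v$ with $v=x\vee y$. A *join-decomposition* of $v$ of size $k$ is a finite family $p^0,\dots,p^{k-1}$ in $P$ whose join is $v$; it is *reduced* if for every $i$ the join of the $p^j$ with $j\ne i$ is not $v$ (the empty join being the least element, so that a one-element family $p^0=v$ is reduced iff $v$ is not minimal), and *indecomposable* if all $p^i$ are join-irreducible. The *join-dimension* $\operatorname{jdim}(v)\in\mathbb N\cup\{\infty\}$ is $0$ if $v$ is minimal, $k$ if $v$ is not minimal and has a reduced indecomposable join-decomposition of size $k$ (this size is unique), and $\infty$ otherwise. Put $P_{\le k}=\{v\in P:\operatorname{jdim}(v)\le k\}$. We call $P$ a *join-factorization lattice* if it has a minimal element and there are a distributive lattice $Q$ satisfying the descending chain condition and an order-preserving map $f\colon P\to Q$ with $\operatorname{jdim}(f(v))=\operatorname{jdim}(v)$ for all $v\in P$. Let $\mathscr M$ be a model category with all small colimits which is *good*: for every small poset $I$, the category $\operatorname{Fun}(I,\mathscr M)$ admits the projective model structure (weak equivalences and fibrations objectwise, cofibrations the maps with the left lifting property with respect to objectwise acyclic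 fibrations). Homotopy colimits and homotopy left Kan extensions are computed as $\operatorname{hocolim}_I G=\operatorname{colim}_I QG$ and $\operatorname{hoLan}_\alpha G=\operatorname{Lan}_\alpha QG$ for a projectively cofibrant replacement $QG\to G$. Let $F\colon P\to\mathscr M$ be a functor from a (small) distributive lattice. For $k\in\mathbb N$ let $T_kF\colon P\to\mathscr M$ be the homotopy left Kan extension of $F|_{P_{\le k}}$ along the inclusion $P_{\le k}\hookrightarrow P$, computed with a cofibrant replacement $Q_k\to F|_{P_{\le k}}$. Let $\varepsilon_k\colon T_kF\to F$ be the map induced by $Q_k\to F|_{P_{\le k}}$, and let $r_k\colon T_kF\to T_{k+1}F$ be the map induced by a chosen map $Q_k\to Q_{k+1}|_{P_{\le k}}$ over $F|_{P_{\le k}}$; then $\varepsilon_{k+1}\circ r_k=\varepsilon_k$. The *Taylor telescope* of $F$ is $T_0F\xrightarrow{r_0}T_1F\xrightarrow{r_1}T_2F\to\cdots$, with the cocone $(\varepsilon_k)_k$ to $F$. **Proposition (convergence of the Taylor telescope).** Let $P$ be a join-factorization lattice, $\mathscr M$ a good model category and $F\colon P\to\mathscr M$ a functor. For $x\in P$ let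 $\operatorname{hocolim}_k T_kF(x)$ be the homotopy colimit of the telescope $T_0F(x)\to T_1F(x)\to T_2F(x)\to\cdots$. Then, for every $x\in P$ (and for all choices of the cofibrant replacements and comparison maps above), the map $$\operatorname{hocolim}_k T_kF(x)\to F(x)$$ induced by the maps $(\varepsilon_k)_x$ is a weak equivalence. -/

import Mathlib

open CategoryTheory CategoryTheory.Limits HomotopicalAlgebra

universe v u

namespace PosetCocalculus

/-! ## Join-dimension and join-factorization lattices -/

/-- `v` is join-irreducible: it is not the join of two strictly smaller elements
(so a least element counts as join-irreducible). -/
def IsJoinIrreducible {P : Type*} [Lattice P] (v : P) : Prop :=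
  ¬ ∃ x y : P, x < v ∧ y < v ∧ v = x ⊔ y

/-- `p 0, …, p (k - 1)` is a join-decomposition of `v`: `v` is the join of the `p i`
(a least element is the join of the empty family). -/
def IsJoinDecomposition {P : Type*} [Lattice P] {k : ℕ} (p : Fin k → P) (v : P) : Prop :=
  IsLUB (Set.range p) v

/-- The join-decomposition `p` of `v` is reduced: no `p i` is redundant, i.e. `v` is not the join of
the `p j` with `j ≠ i`. For `k = 1` this says that `v` is not the join of the empty family, i.e.
that `v` is not minimal. -/
def IsReduced {P : Type*} [Lattice P] {k : ℕ} (p : Fin k → P) (v : P) : Prop :=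
  ∀ i, ¬ IsLUB (p '' {j | j ≠ i}) v

/-- `v` has a reduced join-decomposition of size `k` into join-irreducible elements. -/
def HasReducedIndecomposable {P : Type*} [Lattice P] (v : P) (k : ℕ) : Prop :=
  ∃ p : Fin k → P, IsJoinDecomposition p v ∧ IsReduced p v ∧ ∀ i, IsJoinIrreducible (p i)

open Classical in
/-- The join-dimension of an element of a distributive lattice. The size of a reduced indecomposable
join-decomposition is unique, see `jdim_eq`. -/
noncomputable def jdim {P : Type*} [DistribLattice P] (v : P) : ℕ∞ :=
  if IsMin v then 0
  else if h : ∃ k : ℕ, HasReducedIndecomposable v k then (h.choose : ℕ∞)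
  else ⊤

/-- In a distributive lattice, a join-irreducible element that is not minimal lies below a finite
join only if it lies below one of its terms. -/
lemma IsJoinIrreducible.le_of_isLUB {P : Type*} [DistribLattice P] {v w : P}
    (hv : IsJoinIrreducible v) (h0 : ¬ IsMin v) {s : Set P} (hs : s.Finite) (hw : IsLUB s w)
    (h : v ≤ w) : ∃ a ∈ s, v ≤ a := by
  have hp : SupPrime v := supPrime_iff_supIrred.2 ⟨h0, fun {b c} hbc ↦ by
    by_contra! hne
    exact hv ⟨b, c, lt_of_le_of_ne (hbc ▸ le_sup_left) hne.1,
      lt_of_le_of_ne (hbc ▸ le_sup_right) hne.2, hbc.symm⟩⟩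
  induction s, hs using Set.Finite.induction_on generalizing w with
  | empty => exact (h0 fun y _ ↦ h.trans (hw.2 (by simp))).elim
  | @insert a s _ hs ih =>
    by_contra! hne
    rcases s.eq_empty_or_nonempty with rfl | hs'
    · exact hne a (by simp) (by
        rw [insert_empty_eq] at hw
        exact h.trans_eq (hw.unique isLUB_singleton))
    · obtain ⟨u, hu⟩ : ∃ u, IsLUB s u := by
        have := hs.toFinset.isLUB_sup' (by simpa using hs')
        exact ⟨_, by simpa using this⟩
      rw [hw.unique (hu.insert a)] at h
      rcases hp.2 h with h | h
      · exact hne a (by simp) h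
      · obtain ⟨b, hb, hvb⟩ := ih hu h
        exact hne b (by simp [hb]) hvb

/-- Uniqueness of the size of a reduced indecomposable join-decomposition. -/
lemma HasReducedIndecomposable.le {P : Type*} [DistribLattice P] {v : P} {k l : ℕ}
    (hk : HasReducedIndecomposable v k) (hl : HasReducedIndecomposable v l) : k ≤ l := by
  obtain ⟨p, hp, hpr, hpi⟩ := hk
  obtain ⟨q, hq, hqr, hqi⟩ := hl
  have hmin {n : ℕ} {p : Fin n → P} (hp : IsJoinDecomposition p v) (hpr : IsReduced p v) (i) :
      ¬ IsMin (p i) := by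
    intro h
    have hle : ∀ y, p i ≤ y := fun y ↦ (h inf_le_left).trans inf_le_right
    refine hpr i ⟨?_, fun b hb ↦ hp.2 ?_⟩
    · rintro _ ⟨j, -, rfl⟩
      exact hp.1 ⟨j, rfl⟩
    · rintro _ ⟨j, rfl⟩
      by_cases hj : j = i
      · exact hj ▸ hle b
      · exact hb ⟨j, hj, rfl⟩
  have hanti {n : ℕ} {p : Fin n → P} (hp : IsJoinDecomposition p v) (hpr : IsReduced p v)
      {i j : Fin n} (h : p i ≤ p j) : i = j := by
    by_contra hij
    refine hpr i ⟨?_, fun b hb ↦ hp.2 ?_⟩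
    · rintro _ ⟨j, -, rfl⟩
      exact hp.1 ⟨j, rfl⟩
    · rintro _ ⟨m, rfl⟩
      by_cases hm : m = i
      · exact hm ▸ h.trans (hb ⟨j, fun h ↦ hij h.symm, rfl⟩)
      · exact hb ⟨m, hm, rfl⟩
  have hf (i) : ∃ j, p i ≤ q j := by
    obtain ⟨_, ⟨j, rfl⟩, h⟩ := (hpi i).le_of_isLUB (hmin hp hpr i) (Set.finite_range q) hq
      (hp.1 ⟨i, rfl⟩)
    exact ⟨j, h⟩
  have hg (j) : ∃ i, q j ≤ p i := by
    obtain ⟨_, ⟨i, rfl⟩, h⟩ := (hqi j).le_of_isLUB (hmin hq hqr j) (Set.finite_range p) hp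
      (hq.1 ⟨j, rfl⟩)
    exact ⟨i, h⟩
  choose f hf using hf
  choose g hg using hg
  have : Function.Injective f := fun i i' h ↦
    (hanti hp hpr ((hf i).trans (hg _))).trans
      (hanti hp hpr ((hf i').trans (h ▸ hg _))).symm
  simpa using Fintype.card_le_of_injective f this

/-- The join-dimension of `v` is the size of any reduced indecomposable join-decomposition. -/
theorem jdim_eq {P : Type*} [DistribLattice P] {v : P} {k : ℕ}
    (h : HasReducedIndecomposable v k) : jdim v = k := by
  by_cases hv : IsMin v
  · have h0 : HasReducedIndecomposable v 0 :=
      ⟨Fin.elim0, by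
        rw [IsJoinDecomposition, Set.range_eq_empty, isLUB_empty_iff]
        exact fun y ↦ (hv (inf_le_left : v ⊓ y ≤ v)).trans inf_le_right,
        fun i ↦ i.elim0, fun i ↦ i.elim0⟩
    have : k = 0 := le_antisymm (h.le h0) (Nat.zero_le k)
    simp [jdim, hv, this]
  · have hex : ∃ k : ℕ, HasReducedIndecomposable v k := ⟨k, h⟩
    rw [jdim, if_neg hv, dif_pos hex,
      le_antisymm (hex.choose_spec.le h) (h.le hex.choose_spec)]

/-- A join-factorization lattice: a distributive lattice `P` with a minimal element such that some
order-preserving map from `P` to a distributive lattice with the descending chain condition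
preserves join-dimension. -/
def IsJoinFactorizationLattice (P : Type u) [DistribLattice P] : Prop :=
  (∃ b : P, IsMin b) ∧
    ∃ (Q : Type u) (_ : DistribLattice Q), WellFoundedLT Q ∧
      ∃ f : P →o Q, ∀ v : P, jdim (f v) = jdim v

/-- The poset `P_{≤ k}` of the elements of join-dimension at most `k`. -/
abbrev JDimLE (P : Type u) [DistribLattice P] (k : ℕ) : Type u :=
  {v : P // jdim v ≤ (k : ℕ∞)}

/-- The inclusion of `P_{≤ k}` into `P`. -/
def incl (P : Type u) [DistribLattice P] (k : ℕ) : JDimLE P k ⥤ P :=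
  Monotone.functor (f := fun a : JDimLE P k ↦ a.1) (fun _ _ h ↦ h)

/-- The inclusion of `P_{≤ k}` into `P_{≤ k + 1}`. -/
def inclSucc (P : Type u) [DistribLattice P] (k : ℕ) : JDimLE P k ⥤ JDimLE P (k + 1) :=
  Monotone.functor
    (f := fun a : JDimLE P k ↦
      (⟨a.1, a.2.trans (Nat.cast_le.2 (Nat.le_succ k))⟩ : JDimLE P (k + 1)))
    (fun _ _ h ↦ h)

/-! ## Projective model structures, homotopy colimits, homotopy left Kan extensions -/

/-- The projective cofibrations of `Fun(I, M)`: the natural transformations with the left lifting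
property with respect to the objectwise acyclic fibrations. -/
def projectiveCofibrations (I : Type*) [Category* I] (M : Type u) [Category.{v} M]
    [ModelCategory M] : MorphismProperty (I ⥤ M) :=
  ((trivialFibrations M).functorCategory I).llp

/-- `Fun(I, M)` admits the projective model structure. -/
def AdmitsProjectiveModelStructure (I : Type*) [Category* I] (M : Type u) [Category.{v} M]
    [ModelCategory M] : Prop :=
  ∃ m : ModelCategory (I ⥤ M),
    m.categoryWithWeakEquivalences.weakEquivalences = (weakEquivalences M).functorCategory I ∧
    m.categoryWithFibrations.fibrations = (fibrations M).functorCategory I ∧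
    m.categoryWithCofibrations.cofibrations = projectiveCofibrations I M

/-- A good model category: `Fun(I, M)` admits the projective model structure for every (small)
poset `I`. -/
class IsGood (M : Type u) [Category.{v} M] [ModelCategory M] : Prop where
  admits (I : Type v) [PartialOrder I] : AdmitsProjectiveModelStructure I M

/-- A cofibrant replacement of a diagram `G` for the projective model structure: a projectively
cofibrant diagram with an objectwise weak equivalence to `G`. -/
structure CofibrantReplacement {I : Type*} [Category* I] {M : Type u} [Category.{v} M]
    [ModelCategory M] (G : I ⥤ M) where
  /-- the cofibrant diagram -/
  diagram : I ⥤ M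
  /-- the map to `G` -/
  map : diagram ⟶ G
  cofibrant : projectiveCofibrations I M (initial.to diagram)
  weakEquivalence (i : I) : WeakEquivalence (map.app i)

namespace CofibrantReplacement

variable {I J : Type*} [Category* I] [Category* J] {M : Type u} [Category.{v} M]
  [ModelCategory M] {G : I ⥤ M}

/-- The homotopy colimit of `G`, computed with the cofibrant replacement `R`. -/
noncomputable def hocolim (R : CofibrantReplacement G) [HasColimit R.diagram] : M :=
  colimit R.diagram

/-- The map from the homotopy colimit of `G` induced by a cocone on `G`. -/
noncomputable def hocolimDesc (R : CofibrantReplacement G) [HasColimit R.diagram]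
    (c : Cocone G) : R.hocolim ⟶ c.pt :=
  colimit.desc R.diagram { pt := c.pt, ι := R.map ≫ c.ι }

/-- The homotopy left Kan extension of `G` along `α`, computed with the cofibrant
replacement `R`. -/
noncomputable def hoLan (R : CofibrantReplacement G) (α : I ⥤ J)
    [α.HasLeftKanExtension R.diagram] : J ⥤ M :=
  α.leftKanExtension R.diagram

/-- The unit of the (left Kan extension defining the) homotopy left Kan extension. -/
noncomputable def hoLanUnit (R : CofibrantReplacement G) (α : I ⥤ J)
    [α.HasLeftKanExtension R.diagram] : R.diagram ⟶ α ⋙ R.hoLan α :=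
  α.leftKanExtensionUnit R.diagram

instance (R : CofibrantReplacement G) (α : I ⥤ J) [α.HasLeftKanExtension R.diagram] :
    (R.hoLan α).IsLeftKanExtension (R.hoLanUnit α) :=
  inferInstanceAs
    ((α.leftKanExtension R.diagram).IsLeftKanExtension (α.leftKanExtensionUnit R.diagram))

/-- The map out of the homotopy left Kan extension which corresponds to a map
`R.diagram ⟶ α ⋙ H`. -/
noncomputable def hoLanDesc (R : CofibrantReplacement G) (α : I ⥤ J)
    [α.HasLeftKanExtension R.diagram] (H : J ⥤ M) (φ : R.diagram ⟶ α ⋙ H) : R.hoLan α ⟶ H :=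
  (R.hoLan α).descOfIsLeftKanExtension (R.hoLanUnit α) H φ

lemma hoLan_fac_app (R : CofibrantReplacement G) (α : I ⥤ J)
    [α.HasLeftKanExtension R.diagram] (H : J ⥤ M) (φ : R.diagram ⟶ α ⋙ H) (i : I) :
    (R.hoLanUnit α).app i ≫ (R.hoLanDesc α H φ).app (α.obj i) = φ.app i :=
  Functor.descOfIsLeftKanExtension_fac_app _ _ _ _ _

lemma hoLan_hom_ext (R : CofibrantReplacement G) (α : I ⥤ J)
    [α.HasLeftKanExtension R.diagram] {H : J ⥤ M} {f g : R.hoLan α ⟶ H}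
    (h : ∀ i, (R.hoLanUnit α).app i ≫ f.app (α.obj i) =
      (R.hoLanUnit α).app i ≫ g.app (α.obj i)) :
    f = g :=
  (R.hoLan α).hom_ext_of_isLeftKanExtension (R.hoLanUnit α) f g (by ext i; exact h i)

end CofibrantReplacement

/-- If `Fun(I, M)` has the projective model structure, every diagram has a cofibrant replacement,
whose map may be taken to be an objectwise acyclic fibration. -/
theorem AdmitsProjectiveModelStructure.exists_replacement {I : Type*} [Category* I] {M : Type u}
    [Category.{v} M] [ModelCategory M] (h : AdmitsProjectiveModelStructure I M) (G : I ⥤ M) :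
    ∃ R : CofibrantReplacement G, (trivialFibrations M).functorCategory I R.map := by
  obtain ⟨m, hw, hf, hc⟩ := h
  let d := MorphismProperty.factorizationData (@cofibrations (I ⥤ M) _ _)
    (@trivialFibrations (I ⥤ M) _ _ _) (initial.to G)
  have h₁ : (fibrations M).functorCategory I d.p := by rw [← hf]; exact d.hp.1
  have h₂ : (weakEquivalences M).functorCategory I d.p := by rw [← hw]; exact d.hp.2
  have h₃ : projectiveCofibrations I M d.i := by rw [← hc]; exact d.hi
  refine ⟨⟨d.Z, d.p, ?_, fun i ↦ ⟨h₂ i⟩⟩, fun i ↦ ⟨h₁ i, h₂ i⟩⟩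
  rwa [Subsingleton.elim (initial.to d.Z) d.i]

/-- Every telescope in a good model category has a cofibrant replacement. -/
theorem CofibrantReplacement.nonempty_of_nat {M : Type u} [Category.{v} M]
    [ModelCategory M] [IsGood M] (G : ℕ ⥤ M) : Nonempty (CofibrantReplacement G) := by
  let up : ℕ ⥤ ULift.{v} ℕ := Monotone.functor (f := ULift.up) (fun _ _ h ↦ h)
  let down : ULift.{v} ℕ ⥤ ℕ := Monotone.functor (f := ULift.down) (fun _ _ h ↦ h)
  obtain ⟨R, -⟩ := (IsGood.admits (M := M) (ULift.{v} ℕ)).exists_replacement (down ⋙ G)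
  refine ⟨⟨up ⋙ R.diagram, Functor.whiskerLeft up R.map, fun X Y p hp ↦ ⟨fun {f g} sq ↦ ?_⟩,
    fun i ↦ R.weakEquivalence _⟩⟩
  let p' : down ⋙ X ⟶ down ⋙ Y := Functor.whiskerLeft down p
  let g' : R.diagram ⟶ down ⋙ Y := Functor.whiskerLeft down g
  have : HasLiftingProperty (initial.to R.diagram) p' := R.cofibrant p' fun a ↦ hp _
  have sq' : CommSq (initial.to (down ⋙ X)) (initial.to R.diagram) p' g' :=
    ⟨Subsingleton.elim _ _⟩
  refine ⟨⟨⟨Functor.whiskerLeft up sq'.lift, Subsingleton.elim _ _, ?_⟩⟩⟩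
  ext i
  exact NatTrans.congr_app sq'.fac_right (up.obj i)

/-! ## The Taylor telescope -/

/-- The choices needed to realise the Taylor telescope of `F : P ⥤ M` by honest natural
transformations: for each `k` a cofibrant replacement of the restriction of `F` to `P_{≤ k}`, and
comparison maps from the `k`-th one to the restriction of the `(k + 1)`-st one, over the
restriction of `F`. -/
structure TaylorModel {P : Type v} [DistribLattice P] {M : Type u} [Category.{v} M]
    [ModelCategory M] (F : P ⥤ M) where
  /-- a cofibrant replacement of the restriction of `F` to `P_{≤ k}` -/
  Q (k : ℕ) : CofibrantReplacement (incl P k ⋙ F)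
  /-- the comparison maps -/
  comparison (k : ℕ) : (Q k).diagram ⟶ inclSucc P k ⋙ (Q (k + 1)).diagram
  comparison_fac (k : ℕ) (a : JDimLE P k) :
    (comparison k).app a ≫ (Q (k + 1)).map.app ((inclSucc P k).obj a) = (Q k).map.app a

/-- Taylor models exist for every functor to a good model category. -/
theorem TaylorModel.nonempty {P : Type v} [DistribLattice P] {M : Type u} [Category.{v} M]
    [ModelCategory M] [IsGood M] (F : P ⥤ M) : Nonempty (TaylorModel F) := by
  choose Q hQ using fun k ↦
    (IsGood.admits (M := M) (JDimLE P k)).exists_replacement (incl P k ⋙ F)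
  have key (k : ℕ) : ∃ c : (Q k).diagram ⟶ inclSucc P k ⋙ (Q (k + 1)).diagram,
      ∀ a, c.app a ≫ (Q (k + 1)).map.app ((inclSucc P k).obj a) = (Q k).map.app a := by
    let p : inclSucc P k ⋙ (Q (k + 1)).diagram ⟶ incl P k ⋙ F :=
      Functor.whiskerLeft (inclSucc P k) (Q (k + 1)).map
    have : HasLiftingProperty (initial.to (Q k).diagram) p :=
      (Q k).cofibrant p fun a ↦ hQ (k + 1) _
    have sq : CommSq (initial.to _) (initial.to (Q k).diagram) p (Q k).map :=
      ⟨Subsingleton.elim _ _⟩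
    exact ⟨sq.lift, NatTrans.congr_app sq.fac_right⟩
  choose c hc using key
  exact ⟨⟨Q, c, hc⟩⟩

namespace TaylorModel

variable {P : Type v} [DistribLattice P] {M : Type u} [Category.{v} M]
  [ModelCategory M] [HasColimits M] {F : P ⥤ M}

/-- The codegree `k` approximation `T_k F`: the homotopy left Kan extension of the restriction of
`F` to `P_{≤ k}` along the inclusion of `P_{≤ k}` into `P`. -/
noncomputable def T (D : TaylorModel F) (k : ℕ) : P ⥤ M :=
  (D.Q k).hoLan (incl P k)

/-- The canonical map `ε_k : T_k F ⟶ F`. -/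
noncomputable def ε (D : TaylorModel F) (k : ℕ) : D.T k ⟶ F :=
  (D.Q k).hoLanDesc (incl P k) F (D.Q k).map

/-- The composite of the comparison map with the unit of `T_{k + 1} F`. -/
noncomputable def comparisonUnit (D : TaylorModel F) (k : ℕ) :
    (D.Q k).diagram ⟶ incl P k ⋙ D.T (k + 1) where
  app a := (D.comparison k).app a ≫
    ((D.Q (k + 1)).hoLanUnit (incl P (k + 1))).app ((inclSucc P k).obj a)
  naturality a b f := by
    have h₁ := (D.comparison k).naturality f
    have h₂ := ((D.Q (k + 1)).hoLanUnit (incl P (k + 1))).naturality ((inclSucc P k).map f)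
    exact (Category.assoc _ _ _).symm.trans ((congr_arg (· ≫ _) h₁).trans
      ((Category.assoc _ _ _).trans ((congr_arg (_ ≫ ·) h₂).trans
        (Category.assoc _ _ _).symm)))

/-- The canonical map `r_k : T_k F ⟶ T_{k + 1} F` induced by the comparison map. -/
noncomputable def r (D : TaylorModel F) (k : ℕ) : D.T k ⟶ D.T (k + 1) :=
  (D.Q k).hoLanDesc (incl P k) (D.T (k + 1)) (D.comparisonUnit k)

lemma r_comp_ε (D : TaylorModel F) (k : ℕ) : D.r k ≫ D.ε (k + 1) = D.ε k := by
  apply (D.Q k).hoLan_hom_ext (incl P k)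
  intro a
  have h₁ := (D.Q k).hoLan_fac_app (incl P k) F (D.Q k).map a
  have h₂ := (D.Q k).hoLan_fac_app (incl P k) (D.T (k + 1)) (D.comparisonUnit k) a
  have h₃ := (D.Q (k + 1)).hoLan_fac_app (incl P (k + 1)) F (D.Q (k + 1)).map
    ((inclSucc P k).obj a)
  exact (Category.assoc _ _ _).symm.trans ((congr_arg (· ≫ _) h₂).trans
    ((Category.assoc _ _ _).trans ((congr_arg (_ ≫ ·) h₃).trans
      ((D.comparison_fac k a).trans h₁.symm))))

/-- The Taylor telescope `T_0 F ⟶ T_1 F ⟶ T_2 F ⟶ ⋯`. -/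
noncomputable def telescope (D : TaylorModel F) : ℕ ⥤ (P ⥤ M) :=
  Functor.ofSequence D.r

/-- The cocone on the Taylor telescope with point `F` and components the `ε_k`. -/
noncomputable def telescopeCocone (D : TaylorModel F) : Cocone D.telescope where
  pt := F
  ι := NatTrans.ofSequence (F := D.telescope) (G := (Functor.const ℕ).obj F) D.ε (fun n ↦ by
      have h := Functor.ofSequence_map_homOfLE_succ D.r n
      exact (congr_arg (· ≫ D.ε (n + 1)) h).trans
        ((D.r_comp_ε n).trans (Category.comp_id _).symm))

/-- The telescope `T_0 F (x) ⟶ T_1 F (x) ⟶ T_2 F (x) ⟶ ⋯`. -/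
noncomputable def telescopeAt (D : TaylorModel F) (x : P) : ℕ ⥤ M :=
  D.telescope ⋙ (evaluation P M).obj x

/-- The cocone on `T_0 F (x) ⟶ T_1 F (x) ⟶ ⋯` with point `F (x)` and components the
`(ε_k)_x`. -/
noncomputable def telescopeCoconeAt (D : TaylorModel F) (x : P) : Cocone (D.telescopeAt x) :=
  ((evaluation P M).obj x).mapCocone D.telescopeCocone

end TaylorModel

end PosetCocalculus

/-!
In a lattice with the descending chain condition every element is a finite join of join-irreducible
elements, and a decomposition of least cardinality is reduced. Hence all join-dimensions in a
join-factorization lattice `P` are finite, so a given `x : P` lies in `P_{≤ k}` for all large `k`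
(`IsJoinFactorizationLattice.exists_jdim_le`). As `P_{≤ k} ⊆ P` is full, the left Kan extension
along it does not change values on `P_{≤ k}`, so `(ε_k)_x` is a weak equivalence for all large `k`
(`TaylorModel.weakEquivalence_ε_app`).

It remains to see that the homotopy colimit of a telescope `G` whose structure maps to `A` are
eventually weak equivalences is weakly equivalent to `A`
(`CofibrantReplacement.weakEquivalence_hocolimDesc`). The transition maps of a projectively
cofibrant telescope `D` are cofibrations (`cofibration_map_succ`). If `D ⟶ G` is a replacement, the
transition maps `D_k ⟶ D_{k + 1}` are trivial cofibrations for `k ≥ n` by two-out-of-three, hence so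
is their transfinite composition `D_n ⟶ colim D`, and two-out-of-three applies to
`D_n ⟶ colim D ⟶ A`.
-/

namespace PosetCocalculus

universe w

/-! ### Finiteness of the join-dimension -/

lemma exists_finset_isLUB_isJoinIrreducible {Q : Type*} [Lattice Q] [WellFoundedLT Q] (v : Q) :
    ∃ s : Finset Q, IsLUB (s : Set Q) v ∧ ∀ a ∈ s, IsJoinIrreducible a := by
  classical
  induction v using WellFoundedLT.induction with
  | ind v ih =>
    by_cases hv : IsJoinIrreducible v
    · exact ⟨{v}, by simp, by simpa using hv⟩
    · obtain ⟨x, y, hx, hy, rfl⟩ := not_not.1 hv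
      obtain ⟨s, hs, hs'⟩ := ih x hx
      obtain ⟨t, ht, ht'⟩ := ih y hy
      refine ⟨s ∪ t, by simpa using hs.union ht, fun a ha ↦ ?_⟩
      exact (Finset.mem_union.1 ha).elim (hs' a) (ht' a)

lemma exists_hasReducedIndecomposable {Q : Type*} [Lattice Q] [WellFoundedLT Q] (v : Q) :
    ∃ k, HasReducedIndecomposable v k := by
  classical
  -- A decomposition of least cardinality is reduced.
  have hex : ∃ k, ∃ s : Finset Q, s.card = k ∧ IsLUB (s : Set Q) v ∧
      ∀ a ∈ s, IsJoinIrreducible a :=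
    (exists_finset_isLUB_isJoinIrreducible v).elim fun s hs ↦ ⟨_, s, rfl, hs⟩
  obtain ⟨s, hcard, hs, hirr⟩ := Nat.find_spec hex
  refine ⟨s.card, fun i ↦ (s.equivFin.symm i : Q), ?_, fun i hi ↦ ?_,
    fun i ↦ hirr _ (s.equivFin.symm i).2⟩
  · have : Set.range (fun i ↦ (s.equivFin.symm i : Q)) = s := by
      ext a
      exact ⟨by rintro ⟨i, rfl⟩; exact (s.equivFin.symm i).2,
        fun ha ↦ ⟨s.equivFin ⟨a, ha⟩, by simp⟩⟩
    rwa [IsJoinDecomposition, this]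
  · have himage : (fun j ↦ (s.equivFin.symm j : Q)) '' {j | j ≠ i} =
        (s.erase (s.equivFin.symm i : Q) : Finset Q) := by
      ext a
      simp only [Set.mem_image, Set.mem_ofPred_eq, Finset.coe_erase, Set.mem_sdiff,
        Finset.mem_coe, Set.mem_singleton_iff]
      constructor
      · rintro ⟨j, hj, rfl⟩
        exact ⟨(s.equivFin.symm j).2, fun h ↦ hj (s.equivFin.symm.injective (Subtype.ext h))⟩
      · rintro ⟨ha, hne⟩
        exact ⟨s.equivFin ⟨a, ha⟩, fun h ↦ hne (by simp [← h]), by simp⟩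
    rw [himage] at hi
    refine Nat.find_min hex (m := (s.erase (s.equivFin.symm i : Q)).card) ?_
      ⟨_, rfl, hi, fun a ha ↦ hirr a (Finset.mem_of_mem_erase ha)⟩
    rw [← hcard]
    exact Finset.card_erase_lt_of_mem (s.equivFin.symm i).2

lemma IsJoinFactorizationLattice.exists_jdim_le {P : Type u} [DistribLattice P]
    (hP : IsJoinFactorizationLattice P) (x : P) : ∃ n : ℕ, jdim x ≤ n := by
  obtain ⟨-, Q, _, _, f, hf⟩ := hP
  obtain ⟨k, hk⟩ := exists_hasReducedIndecomposable (f x)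
  exact ⟨k, by rw [← hf, jdim_eq hk]⟩

/-! ### Projectively cofibrant telescopes -/

section

variable {M : Type u} [Category.{v} M] [ModelCategory M]

lemma projectiveCofibrations_initial_iff {I : Type*} [Category* I] (D : I ⥤ M) :
    projectiveCofibrations I M (initial.to D) ↔
      ∀ {X Y : I ⥤ M} (p : X ⟶ Y), (trivialFibrations M).functorCategory I p →
        ∀ g : D ⟶ Y, ∃ l : D ⟶ X, l ≫ p = g := by
  refine ⟨fun h X Y p hp g ↦ ?_, fun h X Y p hp ↦ ⟨fun {f g} sq ↦ ?_⟩⟩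
  · have := h p hp
    have sq : CommSq (initial.to X) (initial.to D) p g := ⟨Subsingleton.elim _ _⟩
    exact ⟨sq.lift, sq.fac_right⟩
  · obtain ⟨l, hl⟩ := h p hp g
    exact ⟨⟨⟨l, Subsingleton.elim _ _, hl⟩⟩⟩

/-- Restriction along a right adjoint `α` preserves projectively cofibrant diagrams: it is left
adjoint to the restriction along the left adjoint of `α`, which preserves objectwise trivial
fibrations. -/
lemma projectiveCofibrations_initial_comp {I J : Type*} [Category* I] [Category* J]
    {L : J ⥤ I} {α : I ⥤ J} (adj : L ⊣ α) {D : J ⥤ M}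
    (hD : projectiveCofibrations J M (initial.to D)) :
    projectiveCofibrations I M (initial.to (α ⋙ D)) := by
  rw [projectiveCofibrations_initial_iff] at hD ⊢
  intro X Y p hp g
  let adj' := adj.whiskerLeft M
  obtain ⟨l, hl⟩ := hD (((Functor.whiskeringLeft J I M).obj L).map p) (fun j ↦ hp (L.obj j))
    (adj'.homEquiv D Y g)
  refine ⟨(adj'.homEquiv D X).symm l, ?_⟩
  rw [← Adjunction.homEquiv_naturality_right_symm, hl, Equiv.symm_apply_apply]

/-- The objects of the telescope `X ⟶ Y ⟶ ⊤ ⟶ ⊤ ⟶ ⋯`. -/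
noncomputable def twoStepObj (X Y : M) : ℕ → M
  | 0 => X
  | 1 => Y
  | _ + 2 => ⊤_ M

/-- The transition maps of the telescope `X ⟶ Y ⟶ ⊤ ⟶ ⊤ ⟶ ⋯`. -/
noncomputable def twoStepMap {X Y : M} (f : X ⟶ Y) :
    ∀ n, twoStepObj X Y n ⟶ twoStepObj X Y (n + 1)
  | 0 => f
  | 1 => terminal.from Y
  | _ + 2 => 𝟙 _

/-- The telescope `X ⟶ Y ⟶ ⊤ ⟶ ⊤ ⟶ ⋯` which starts with the map `f : X ⟶ Y` and continues with the
terminal object. -/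
noncomputable def twoStep {X Y : M} (f : X ⟶ Y) : ℕ ⥤ M :=
  Functor.ofSequence (twoStepMap f)

lemma cofibration_map_zero_one {D : ℕ ⥤ M}
    (hD : projectiveCofibrations ℕ M (initial.to D)) :
    Cofibration (D.map (homOfLE (Nat.le_succ 0))) := by
  rw [projectiveCofibrations_initial_iff] at hD
  rw [cofibration_iff, ← MorphismProperty.llp_eq_of_wfs (cofibrations M) (trivialFibrations M)]
  refine fun X Y p hp ↦ ⟨fun {a b} sq ↦ ?_⟩
  have hid {A : M} : trivialFibrations M (𝟙 A) := MorphismProperty.id_mem _ _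
  -- A lifting problem of `D 0 ⟶ D 1` against `p` is a map from `D` to the telescope starting
  -- with `p`, and a solution is a lift to the telescope starting with `𝟙 X`.
  let π : twoStep (𝟙 X) ⟶ twoStep p := NatTrans.ofSequence
    (fun | 0 => 𝟙 X | 1 => p | _ + 2 => 𝟙 (⊤_ M)) (by
      have hX := Functor.ofSequence_map_homOfLE_succ (twoStepMap (𝟙 X))
      have hp := Functor.ofSequence_map_homOfLE_succ (twoStepMap p)
      rintro (_ | _ | n)
      · exact (congr_arg (· ≫ p) (hX 0)).trans (congr_arg (𝟙 X ≫ ·) (hp 0)).symm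
      · exact (terminalIsTerminal (C := M)).hom_ext _ _
      · exact (terminalIsTerminal (C := M)).hom_ext _ _)
  let g : D ⟶ twoStep p := NatTrans.ofSequence
    (fun | 0 => a | 1 => b | _ + 2 => terminal.from _) (by
      have hp := Functor.ofSequence_map_homOfLE_succ (twoStepMap p)
      rintro (_ | _ | n)
      · exact sq.w.symm.trans (congr_arg (a ≫ ·) (hp 0)).symm
      · exact (terminalIsTerminal (C := M)).hom_ext _ _
      · exact (terminalIsTerminal (C := M)).hom_ext _ _)
  obtain ⟨l, hl⟩ := hD π (by rintro (_ | _ | n); exacts [hid, hp, hid]) g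
  have h0 : l.app 0 ≫ 𝟙 X = a := NatTrans.congr_app hl 0
  have h1 : l.app 1 ≫ p = b := NatTrans.congr_app hl 1
  have hl01 := l.naturality (homOfLE (Nat.le_succ 0))
  have hmap : (twoStep (𝟙 X)).map (homOfLE (Nat.le_succ 0)) = 𝟙 X :=
    Functor.ofSequence_map_homOfLE_succ (twoStepMap (𝟙 X)) 0
  refine ⟨⟨⟨l.app 1, ?_, h1⟩⟩⟩
  rw [hmap] at hl01
  exact hl01.trans h0

lemma cofibration_map_succ {D : ℕ ⥤ M}
    (hD : projectiveCofibrations ℕ M (initial.to D)) (k : ℕ) :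
    Cofibration (D.map (homOfLE (Nat.le_succ k))) := by
  -- The telescope `D` shifted by `k` is the restriction along `i ↦ i + k`, whose left adjoint is
  -- truncated subtraction.
  have gc : GaloisConnection (fun j : ℕ ↦ j - k) (fun i ↦ i + k) :=
    fun _ _ ↦ Nat.sub_le_iff_le_add
  have h := cofibration_map_zero_one (projectiveCofibrations_initial_comp gc.adjunction hD)
  have e : Arrow.mk ((gc.monotone_u.functor ⋙ D).map (homOfLE (Nat.le_succ 0))) =
      Arrow.mk (D.map (homOfLE (Nat.le_succ k))) :=
    congr_arg D.mapArrow.obj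
      (a₁ := Arrow.mk (gc.monotone_u.functor.map (homOfLE (Nat.le_succ 0))))
      (a₂ := Arrow.mk (homOfLE (Nat.le_succ k))) (Arrow.ext (Nat.zero_add k) (Nat.add_comm 1 k) rfl)
  rw [cofibration_iff] at h ⊢
  have h' := ((cofibrations M).arrow_mk_mem_toSet_iff _).2 h
  exact ((cofibrations M).arrow_mk_mem_toSet_iff _).1 (e ▸ h')

/-- If the transition maps of a transfinite composition from stage `j` on belong to a class which is
stable under transfinite composition, then so does the inclusion of stage `j`. -/
lemma incl_app_mem_of_le {C : Type*} [Category* C] (W : MorphismProperty C) {J : Type w}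
    [LinearOrder J] [SuccOrder J] [OrderBot J] [WellFoundedLT J] {X Y : C} {f : X ⟶ Y}
    (t : TransfiniteCompositionOfShape J f) (j : J)
    [MorphismProperty.IsStableUnderTransfiniteComposition.{w} W]
    (h : ∀ i, j ≤ i → W (t.F.map (homOfLE (Order.le_succ i)))) : W (t.incl.app j) := by
  refine MorphismProperty.transfiniteCompositionsOfShape_le W (Set.Ici j) _
    ⟨{ toTransfiniteCompositionOfShape := t.ici j, map_mem := fun i _ ↦ ?_ }⟩
  have hi := h i.1 i.2
  rw [← W.arrow_mk_mem_toSet_iff] at hi ⊢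
  have eq : Arrow.mk ((Subtype.mono_coe _).functor.map (homOfLE (Order.le_succ i))) =
    Arrow.mk (homOfLE (Order.le_succ i.1)) :=
      Arrow.ext rfl (coe_succ_of_mem (i.2.trans (Order.le_succ _))) rfl
  replace eq := congr_arg t.F.mapArrow.obj eq
  convert! hi using 1

/-- The homotopy colimit of a telescope is weakly equivalent to the point of any cocone whose legs
are eventually weak equivalences. -/
lemma CofibrantReplacement.weakEquivalence_hocolimDesc {G : ℕ ⥤ M}
    (R : CofibrantReplacement G) [HasColimit R.diagram] (c : Cocone G) (n : ℕ)
    (hc : ∀ k, n ≤ k → WeakEquivalence (c.ι.app k)) : WeakEquivalence (R.hocolimDesc c) := by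
  let D := R.diagram
  have hleg (k : ℕ) (hk : n ≤ k) : WeakEquivalence (R.map.app k ≫ c.ι.app k) := by
    have := hc k hk
    have := R.weakEquivalence k
    infer_instance
  have htriv (k : ℕ) (hk : n ≤ k) :
      trivialCofibrations M (D.map (homOfLE (Nat.le_succ k))) := by
    have := cofibration_map_succ R.cofibrant k
    have := hleg k hk
    have := hleg (k + 1) (by lia)
    have fac : D.map (homOfLE (Nat.le_succ k)) ≫ (R.map.app (k + 1) ≫ c.ι.app (k + 1)) =
        R.map.app k ≫ c.ι.app k := by
      exact ((R.map ≫ c.ι).naturality (homOfLE (Nat.le_succ k))).trans (Category.comp_id _)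
    have : WeakEquivalence (D.map (homOfLE (Nat.le_succ k))) :=
      weakEquivalence_of_postcomp_of_fac fac
    exact mem_trivialCofibrations _
  let t : TransfiniteCompositionOfShape ℕ (colimit.ι D 0) :=
    { F := D
      isoBot := Iso.refl _
      incl := (colimit.cocone D).ι
      isColimit := colimit.isColimit D }
  have : trivialCofibrations M (colimit.ι D n) := by
    have : MorphismProperty.IsStableUnderTransfiniteComposition.{0} (trivialCofibrations M) := by
      rw [← MorphismProperty.llp_eq_of_wfs (trivialCofibrations M) (fibrations M)]
      infer_instance
    exact incl_app_mem_of_le _ t n htriv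
  let i : D.obj n ⟶ R.hocolim := colimit.ι D n
  have fac : i ≫ R.hocolimDesc c = R.map.app n ≫ c.ι.app n := colimit.ι_desc _ _
  have : WeakEquivalence i := ⟨this.2⟩
  have := hleg n le_rfl
  exact weakEquivalence_of_precomp_of_fac fac

end

/-! ### Values of the Taylor telescope -/

namespace TaylorModel

variable {P : Type v} [DistribLattice P] {M : Type u} [Category.{v} M]
  [ModelCategory M] [HasColimits M] {F : P ⥤ M}

lemma weakEquivalence_ε_app (D : TaylorModel F) {k : ℕ} {x : P} (hx : jdim x ≤ k) :
    WeakEquivalence ((D.ε k).app x) := by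
  let a : JDimLE P k := ⟨x, hx⟩
  have : (incl P k).Faithful := ⟨fun _ ↦ Subsingleton.elim _ _⟩
  have : (incl P k).Full := ⟨fun f ↦ ⟨homOfLE (leOfHom f), Subsingleton.elim _ _⟩⟩
  let i : (D.Q k).diagram.obj a ⟶ (D.T k).obj x := ((D.Q k).hoLanUnit (incl P k)).app a
  let q : (D.Q k).diagram.obj a ⟶ F.obj x := (D.Q k).map.app a
  have fac : i ≫ (D.ε k).app x = q := (D.Q k).hoLan_fac_app (incl P k) F (D.Q k).map a
  -- `P_{≤ k}` is a full subcategory, so the unit of a pointwise Kan extension is invertible.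
  have : IsIso i :=
    (Functor.isPointwiseLeftKanExtensionOfIsLeftKanExtension _ ((D.Q k).hoLanUnit (incl P k))
      ((incl P k).obj a)).isIso_hom_app
  have : WeakEquivalence q := (D.Q k).weakEquivalence a
  exact weakEquivalence_of_precomp_of_fac fac

end TaylorModel

end PosetCocalculus

theorem mainTheorem4 {P : Type v} [DistribLattice P]
    (hP : PosetCocalculus.IsJoinFactorizationLattice P)
    {M : Type u} [Category.{v} M] [ModelCategory M] [HasColimits M] [PosetCocalculus.IsGood M]
    (F : P ⥤ M) (D : PosetCocalculus.TaylorModel F) (x : P)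
    (R : PosetCocalculus.CofibrantReplacement (D.telescopeAt x)) :
    WeakEquivalence (R.hocolimDesc (D.telescopeCoconeAt x)) := by
  obtain ⟨n, hn⟩ := hP.exists_jdim_le x
  exact R.weakEquivalence_hocolimDesc _ n fun k hk ↦
    D.weakEquivalence_ε_app (hn.trans (Nat.cast_le.2 hk))
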